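/- Let $X_i\subseteq\mathbb R^{k_i}$ ($i=1,\dots,n$) be the strategy sets of $n$ agents, let $X=X_1\times\dots\times X_n\subseteq\mathbb R^N$ with $N=\sum_i k_i$ be the joint strategy space, and let $F=(F_1,\dots,F_n):X\to\mathbb R^N$, with $F_i:X\to\mathbb R^{k_i}$ the learning operator of agent $i$, be continuous. Let $\gamma>0$. A learning trajectory is a sequence $(x_t)_{t\ge 0}$ with $x_{t+1}=x_t+\gamma F(x_t)$ for all $t\ge 0$. Let $\mathbf T$ be a trapping region for the learning rate $\gamma$, i.e. a compact set $\mathbf T\subseteq X$ such that $x+\gamma F(x)\in\operatorname{int}\mathbf T$ for all $x\in\mathbf T$, where $\operatorname{int}$ denotes the interior in $\mathbb R^N$. Then: (1) every learning trajectory with $x_0\in\mathbf T$ satisfies $x_t\in\mathbf T$ for all $t\ge 0$; (2) if $\mathbf T$ is moreover convex and nonempty, then there is a learning equilibrium in its interior, i.e. a point $x^*\in\operatorname{int}\mathbf T$ with $F(x^*)=0$. -/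

import Mathlib

/-- The Euclidean space `ℝ^N = ℝ^{k_1} × ⋯ × ℝ^{k_n}`, `N = ∑ i, k i`, written in blocks:
`x i` is the strategy of agent `i`. -/
abbrev JointSpace {n : ℕ} (k : Fin n → ℕ) : Type :=
  PiLp 2 (fun i : Fin n => EuclideanSpace ℝ (Fin (k i)))

/-- The joint strategy space `X_1 × ⋯ × X_n ⊆ ℝ^N`. -/
def jointStrategies {n : ℕ} {k : Fin n → ℕ}
    (X : (i : Fin n) → Set (EuclideanSpace ℝ (Fin (k i)))) : Set (JointSpace k) :=
  {x | ∀ i, x i ∈ X i}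

/-- One step `x ↦ x + γ F(x)` of the learning system with joint learning operator `F`
(whose `i`-th block is the learning operator of agent `i`). -/
noncomputable def learningStep {n : ℕ} {k : Fin n → ℕ} (F : JointSpace k → JointSpace k) (γ : ℝ)
    (x : JointSpace k) : JointSpace k :=
  x + γ • F x

/-- A learning trajectory: `x_{t+1} = x_t + γ F(x_t)` for all `t`. -/
def IsLearningTrajectory {n : ℕ} {k : Fin n → ℕ} (F : JointSpace k → JointSpace k) (γ : ℝ)
    (x : ℕ → JointSpace k) : Prop :=
  ∀ t, x (t + 1) = learningStep F γ (x t)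

/-- A learning equilibrium: a zero of the joint learning operator. -/
def IsLearningEquilibrium {n : ℕ} {k : Fin n → ℕ} (F : JointSpace k → JointSpace k)
    (x : JointSpace k) : Prop :=
  F x = 0

/-- `T` is a trapping region, for the learning rate `γ`, of the learning system with joint learning
operator `F` on the joint strategy space `X_1 × ⋯ × X_n`: a compact subset of the joint strategy
space that is mapped by `x ↦ x + γ F(x)` into its interior in `ℝ^N`. -/
structure IsTrappingRegion {n : ℕ} {k : Fin n → ℕ}
    (X : (i : Fin n) → Set (EuclideanSpace ℝ (Fin (k i))))
    (F : JointSpace k → JointSpace k) (γ : ℝ) (T : Set (JointSpace k)) : Prop where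
  rate_pos : 0 < γ
  subset : T ⊆ jointStrategies X
  isCompact : IsCompact T
  step_mem : ∀ x ∈ T, learningStep F γ x ∈ interior T

open Set Metric MeasureTheory Module Polynomial

section Brouwer

/-! Invariance is induction on time. For the equilibrium, Brouwer gives a fixed point of the step
map in `T`; being its own image it lies in `interior T`, and `γ ≠ 0` forces `F` to vanish there.
Brouwer is reduced to the absence of a C¹ retraction `r` onto a sphere, by the Milnor–Rogers volume
argument. For small `t > 0` the map `x + t • (r x - x)` is a bijection of the ball with positive
Jacobian, so its Jacobian integrates to the volume of the ball. This integral is polynomial in `t`,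
so it also equals the volume at `t = 1`; yet `r` has constant norm, so its Jacobian is zero. -/

theorem exists_polynomial_eval_eq_det_one_add_smul {E : Type*} [AddCommGroup E] [Module ℝ E]
    [FiniteDimensional ℝ E] (A : E →ₗ[ℝ] E) :
    ∃ p : ℝ[X], p.natDegree ≤ finrank ℝ E ∧
      ∀ t : ℝ, p.eval t = LinearMap.det (1 + t • A) := by
  classical
  let b := finBasis ℝ E
  let M := LinearMap.toMatrix b b A
  refine ⟨Matrix.det ((X : ℝ[X]) • M.map C + (1 : Matrix _ _ ℝ).map C), ?_, fun t => ?_⟩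
  · simpa using natDegree_det_X_add_C_le M 1
  · rw [← LinearMap.det_toMatrix b, ← coe_evalRingHom, RingHom.map_det]
    congr 1
    ext i j
    by_cases h : i = j <;> simp [M, LinearMap.toMatrix_one, h] <;> ring

/-- The weights do not depend on `p`, so the identity can be integrated over a family of polynomials
of bounded degree. -/
theorem eval_eq_sum_lagrange_basis {p : ℝ[X]} {s : Finset ℝ} (hp : p.natDegree < s.card) (t : ℝ) :
    p.eval t = ∑ x ∈ s, p.eval x * (Lagrange.basis s id x).eval t := by
  have h := Lagrange.eq_interpolate (s := s) (v := id) (f := p) (injOn_id _)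
    (lt_of_le_of_lt degree_le_natDegree (by exact_mod_cast hp))
  conv_lhs => rw [h]
  simp [Lagrange.interpolate_apply, eval_finsetSum]

/-- Nearest-point projection; its variational inequality makes it 1-Lipschitz. -/
theorem exists_continuous_retraction_of_convex {E : Type*} [NormedAddCommGroup E]
    [InnerProductSpace ℝ E] {T : Set E} (hne : T.Nonempty)
    (hT : IsComplete T) (hconv : Convex ℝ T) :
    ∃ p : E → E, Continuous p ∧ (∀ x, p x ∈ T) ∧ ∀ x ∈ T, p x = x := by
  choose p hp hmin using exists_norm_eq_iInf_of_complete_convex hne hT hconv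
  have hin : ∀ x, ∀ w ∈ T, inner ℝ (x - p x) (w - p x) ≤ 0 := fun x =>
    (norm_eq_iInf_iff_real_inner_le_zero hconv (hp x)).1 (hmin x)
  refine ⟨p, ?_, hp, fun x hx => ?_⟩
  · refine (LipschitzWith.of_dist_le_mul (K := 1) fun x y => ?_).continuous
    rw [NNReal.coe_one, one_mul, dist_eq_norm, dist_eq_norm]
    have h1 := hin x (p y) (hp y)
    have h2 := hin y (p x) (hp x)
    have h3 : inner ℝ (p x - p y) (p x - p y) ≤ inner ℝ (x - y) (p x - p y) := by
      have e : inner ℝ (x - y) (p x - p y) - inner ℝ (p x - p y) (p x - p y) =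
          -inner ℝ (x - p x) (p y - p x) - inner ℝ (y - p y) (p x - p y) := by
        rw [← neg_sub (p x) (p y), inner_neg_right, neg_neg, ← inner_sub_left, ← inner_sub_left]
        congr 1
        abel
      linarith
    rw [real_inner_self_eq_norm_sq] at h3
    have h4 := h3.trans (real_inner_le_norm _ _)
    by_contra! h
    nlinarith [norm_nonneg (x - y), norm_nonneg (p x - p y)]
  · exact (sub_eq_zero.1 (real_inner_self_nonpos.1 (hin x x hx))).symm

variable {E : Type*} [NormedAddCommGroup E] [InnerProductSpace ℝ E] [FiniteDimensional ℝ E]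

/-- A kernel vector would satisfy `v = -(s • A v)` with `s * K < 1`, so the determinant has no zero
on `[0, t]` and keeps the sign of its value 1 at 0. -/
theorem det_one_add_smul_pos {A : E →L[ℝ] E} {K t : ℝ} (hA : ‖A‖ ≤ K) (ht : 0 ≤ t)
    (htK : t * K < 1) : 0 < (1 + t • A).det := by
  have hne : ∀ s ∈ Icc (0 : ℝ) t, LinearMap.det (1 + s • (A : E →ₗ[ℝ] E)) ≠ 0 := by
    intro s hs h0
    obtain ⟨v, hv, hv0⟩ := (Submodule.ne_bot_iff _).1 (LinearMap.bot_lt_ker_of_det_eq_zero h0).ne'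
    have hv' : v = -(s • A v) := eq_neg_of_add_eq_zero_left (by simpa using hv)
    have hpos : 0 < ‖v‖ := norm_pos_iff.2 hv0
    have : ‖v‖ ≤ t * K * ‖v‖ := calc
      ‖v‖ = s * ‖A v‖ := by
        conv_lhs => rw [hv', norm_neg, norm_smul, Real.norm_of_nonneg hs.1]
      _ ≤ t * (K * ‖v‖) := by
        have := A.le_of_opNorm_le hA v
        gcongr
        exact hs.2
      _ = _ := by ring
    nlinarith
  obtain ⟨p, -, hp⟩ := exists_polynomial_eval_eq_det_one_add_smul (A : E →ₗ[ℝ] E)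
  change 0 < LinearMap.det (1 + t • (A : E →ₗ[ℝ] E))
  by_contra! hle
  obtain ⟨s, hs, hs0⟩ := intermediate_value_Icc' ht p.continuous.continuousOn
    (show (0 : ℝ) ∈ Icc (p.eval t) (p.eval 0) by rw [hp, hp]; simpa using hle)
  exact hne s hs (by rw [← hp]; exact hs0)

/-- The convex combinations of the identity with a retraction of a ball onto its boundary are, for
parameters near `0`, bijections of the open ball. -/
theorem exists_pos_forall_image_ball_eq {r : E → E} {R : ℝ} (hr : ContDiff ℝ 1 r)
    (hR : 0 < R) (hnorm : ∀ x, ‖r x‖ = R) (hfix : ∀ x, ‖x‖ = R → r x = x) :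
    ∃ δ > 0, ∀ t ∈ Ioo (0 : ℝ) δ,
      InjOn (fun x => x + t • (r x - x)) (ball 0 R) ∧
      (fun x => x + t • (r x - x)) '' ball 0 R = ball 0 R ∧
      ∀ x ∈ ball (0 : E) R, 0 < (1 + t • (fderiv ℝ r x - 1)).det := by
  have hd : Differentiable ℝ r := hr.differentiable one_ne_zero
  have hcd : Continuous (fun x => fderiv ℝ r x - 1) :=
    (hr.continuous_fderiv one_ne_zero).sub continuous_const
  obtain ⟨C, hC⟩ := (isCompact_closedBall (0 : E) R).exists_bound_of_continuousOn hcd.continuousOn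
  have hderiv : ∀ x, HasFDerivAt (fun x => r x - x) (fderiv ℝ r x - 1) x := fun x =>
    (hd x).hasFDerivAt.sub (hasFDerivAt_id x)
  have hC0 : 0 ≤ C := (norm_nonneg _).trans (hC 0 (mem_closedBall_self hR.le))
  have hlip : ∀ x ∈ closedBall (0 : E) R, ∀ y ∈ closedBall (0 : E) R,
      ‖(r y - y) - (r x - x)‖ ≤ C * ‖y - x‖ := fun x hx y hy =>
    (convex_closedBall (0 : E) R).norm_image_sub_le_of_norm_hasFDerivWithin_le
      (fun z _ => (hderiv z).hasFDerivWithinAt) hC hx hy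
  -- Below this bound both `t * C < 1` and `t < 1` hold, even if `C = 0`.
  refine ⟨1 / (C + 1), by positivity, ?_⟩
  rintro t ⟨ht0, ht⟩
  have htC : t * C < 1 := by
    rw [lt_div_iff₀ (by positivity)] at ht
    linarith
  have ht1 : t < 1 := ht.trans_le ((div_le_one (by positivity)).2 (by linarith))
  set f : E → E := fun x => x + t • (r x - x) with hf
  have hpos : ∀ x ∈ ball (0 : E) R, 0 < (1 + t • (fderiv ℝ r x - 1)).det := fun x hx =>
    det_one_add_smul_pos (hC x (ball_subset_closedBall hx)) ht0.le htC
  have hfc : ContDiff ℝ 1 f := contDiff_id.add (contDiff_const.smul (hr.sub contDiff_id))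
  have hfd : ∀ x, HasFDerivAt f (1 + t • (fderiv ℝ r x - 1)) x := fun x =>
    (hasFDerivAt_id x).add ((hderiv x).const_smul t)
  have hinj : InjOn f (ball 0 R) := by
    intro x hx y hy hxy
    have h1 : y - x = -(t • ((r y - y) - (r x - x))) := by
      have : x + t • (r x - x) = y + t • (r y - y) := hxy
      rw [smul_sub t (r y - y)]
      have h2 : t • (r x - x) = y + t • (r y - y) - x := by rw [← this]; abel
      rw [h2]; abel
    have h2 := hlip x (ball_subset_closedBall hx) y (ball_subset_closedBall hy)
    have h3 : ‖y - x‖ = t * ‖(r y - y) - (r x - x)‖ := by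
      conv_lhs => rw [h1, norm_neg, norm_smul, Real.norm_of_nonneg ht0.le]
    have h4 : ‖y - x‖ ≤ 0 := by
      nlinarith [norm_nonneg (y - x)]
    exact (sub_eq_zero.1 (norm_le_zero_iff.1 h4)).symm
  have hmaps : f '' ball 0 R ⊆ ball 0 R := by
    rintro _ ⟨x, hx, rfl⟩
    rw [mem_ball_zero_iff] at hx ⊢
    calc ‖f x‖ = ‖(1 - t) • x + t • r x‖ := by
          congr 1; simp only [hf]; module
      _ ≤ (1 - t) * ‖x‖ + t * ‖r x‖ := by
          refine (norm_add_le _ _).trans_eq ?_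
          rw [norm_smul, norm_smul, Real.norm_of_nonneg ht0.le, Real.norm_of_nonneg (by linarith)]
      _ < R := by rw [hnorm]; nlinarith
  -- Inverse function theorem at each point.
  have hopen : IsOpen (f '' ball 0 R) := by
    rw [isOpen_iff_mem_nhds]
    rintro _ ⟨x, hx, rfl⟩
    have hs : HasStrictFDerivAt f
        (((1 + t • (fderiv ℝ r x - 1)).toContinuousLinearEquivOfDetNeZero (hpos x hx).ne' :
          E ≃L[ℝ] E) : E →L[ℝ] E) x := by
      rw [ContinuousLinearMap.coe_toContinuousLinearEquivOfDetNeZero]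
      exact hfc.contDiffAt.hasStrictFDerivAt' (hfd x) one_ne_zero
    rw [← hs.map_nhds_eq_of_equiv]
    exact Filter.image_mem_map (isOpen_ball.mem_nhds hx)
  refine ⟨hinj, hmaps.antisymm ?_, hpos⟩
  -- The image is also relatively closed in the connected ball: a limit point is `f x` with `‖x‖ ≤
  -- R`, and `f` fixes the sphere.
  refine (convex_ball (0 : E) R).isPreconnected.subset_of_closure_inter_subset hopen ?_ ?_
  · have h0 : f 0 ∈ f '' ball 0 R := mem_image_of_mem _ (mem_ball_self hR)
    exact ⟨f 0, hmaps h0, h0⟩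
  · rintro y ⟨hy, hyR⟩
    have hcl : closure (f '' ball 0 R) ⊆ f '' closedBall 0 R :=
      closure_minimal (image_mono ball_subset_closedBall)
        ((isCompact_closedBall (0 : E) R).image hfc.continuous).isClosed
    obtain ⟨x, hx, rfl⟩ := hcl hy
    rcases (mem_closedBall_zero_iff.1 hx).lt_or_eq with h | h
    · exact mem_image_of_mem _ (mem_ball_zero_iff.2 h)
    · have : f x = x := by simp [hf, hfix x h]
      rw [this, mem_ball_zero_iff] at hyR
      exact absurd h hyR.ne

/-- There is no continuously differentiable retraction of a ball onto its boundary. -/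
theorem not_exists_contDiff_retraction_sphere {r : E → E} {R : ℝ} (hr : ContDiff ℝ 1 r)
    (hR : 0 < R) (hnorm : ∀ x, ‖r x‖ = R) (hfix : ∀ x, ‖x‖ = R → r x = x) : False := by
  let _ : MeasurableSpace E := borel E
  have : BorelSpace E := ⟨rfl⟩
  let μ : Measure E := Measure.addHaar
  obtain ⟨δ, hδ, H⟩ := exists_pos_forall_image_ball_eq hr hR hnorm hfix
  have hd : Differentiable ℝ r := hr.differentiable one_ne_zero
  have hint : ∀ t : ℝ, IntegrableOn (fun x => (1 + t • (fderiv ℝ r x - 1)).det) (ball 0 R) μ := by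
    intro t
    have hc : Continuous (fun x => (1 + t • (fderiv ℝ r x - 1)).det) :=
      ContinuousLinearMap.continuous_det.comp (continuous_const.add
        (((hr.continuous_fderiv one_ne_zero).sub continuous_const).const_smul t))
    exact (hc.continuousOn.integrableOn_compact (isCompact_closedBall 0 R)).mono_set
      ball_subset_closedBall
  have hvol : ∀ t ∈ Ioo (0 : ℝ) δ,
      ∫ x in ball 0 R, (1 + t • (fderiv ℝ r x - 1)).det ∂μ = μ.real (ball 0 R) := by
    intro t ht
    obtain ⟨hinj, himage, hpos⟩ := H t ht
    have key := integral_image_eq_integral_abs_det_fderiv_smul μ measurableSet_ball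
      (f' := fun x => 1 + t • (fderiv ℝ r x - 1))
      (fun x _ => ((hasFDerivAt_id x).add
        (((hd x).hasFDerivAt.sub (hasFDerivAt_id x)).const_smul t)).hasFDerivWithinAt)
      hinj (fun _ => (1 : ℝ))
    rw [show (id + t • (r - id) : E → E) = fun x => x + t • (r x - x) from rfl, himage] at key
    simp only [smul_eq_mul, mul_one] at key
    rw [setIntegral_congr_fun measurableSet_ball fun x hx => (abs_of_pos (hpos x hx)).symm, ← key]
    simp
  -- Enough interpolation nodes for degree `finrank ℝ E`, all where the volume is known.
  obtain ⟨s, hsub, hcard⟩ := (Ioo_infinite hδ).exists_subset_card_eq (finrank ℝ E + 1)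
  have hzero : ∀ x, (1 + (1 : ℝ) • (fderiv ℝ r x - 1)).det = 0 := by
    intro x
    by_contra hne
    have h1 : (1 + (1 : ℝ) • (fderiv ℝ r x - 1)) = fderiv ℝ r x := by simp
    rw [h1] at hne
    -- Along a `v` that the derivative sends to `r x`, the constant `‖r‖ ^ 2` would have derivative
    -- `2 * R ^ 2`.
    obtain ⟨v, hv⟩ :=
      ((fderiv ℝ r x).toContinuousLinearEquivOfDetNeZero hne).surjective (r x)
    have hv' : fderiv ℝ r x v = r x := hv
    have hsq := (hd x).hasFDerivAt.norm_sq
    have hconst : HasFDerivAt (fun y => ‖r y‖ ^ 2) (0 : E →L[ℝ] ℝ) x := by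
      simp only [hnorm]
      exact hasFDerivAt_const _ _
    have h0 := DFunLike.congr_fun (hsq.unique hconst) v
    simp [hv', hnorm, hR.ne'] at h0
  have hlag : ∀ x, (1 + (1 : ℝ) • (fderiv ℝ r x - 1)).det =
      ∑ t ∈ s, (1 + t • (fderiv ℝ r x - 1)).det * (Lagrange.basis s id t).eval 1 := by
    intro x
    obtain ⟨p, hp, hpe⟩ := exists_polynomial_eval_eq_det_one_add_smul
      ((fderiv ℝ r x - 1 : E →L[ℝ] E) : E →ₗ[ℝ] E)
    have := eval_eq_sum_lagrange_basis (p := p) (s := s) (by omega) 1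
    simp only [hpe] at this
    exact this
  have hsum : ∑ t ∈ s, (Lagrange.basis s id t).eval (1 : ℝ) = 1 := by
    have := eval_eq_sum_lagrange_basis (p := 1) (s := s) (by simp [hcard]) 1
    simpa using this.symm
  have hV : 0 < μ.real (ball 0 R) :=
    ENNReal.toReal_pos (measure_ball_pos μ 0 hR).ne' measure_ball_lt_top.ne
  have : (0 : ℝ) = μ.real (ball 0 R) := calc
    (0 : ℝ) = ∫ x in ball 0 R, (1 + (1 : ℝ) • (fderiv ℝ r x - 1)).det ∂μ := by simp only [hzero]; simp
    _ = ∑ t ∈ s, (∫ x in ball 0 R, (1 + t • (fderiv ℝ r x - 1)).det ∂μ) *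
          (Lagrange.basis s id t).eval 1 := by
      simp only [hlag]
      rw [integral_finsetSum _ fun t _ => (hint t).mul_const _]
      simp only [integral_mul_const]
    _ = ∑ t ∈ s, μ.real (ball 0 R) * (Lagrange.basis s id t).eval 1 :=
      Finset.sum_congr rfl fun t ht => by rw [hvol t (hsub ht)]
    _ = μ.real (ball 0 R) := by rw [← Finset.mul_sum, hsum, mul_one]
  exact hV.ne this

/-- **Brouwer's fixed point theorem** for bounded continuous self-maps of a Euclidean space. -/
theorem exists_eq_self_of_continuous_of_norm_le {f : E → E} (hf : Continuous f) {M : ℝ}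
    (hM : ∀ x, ‖f x‖ ≤ M) : ∃ x, f x = x := by
  by_contra! hne
  have hM0 : 0 ≤ M := (norm_nonneg _).trans (hM 0)
  -- Cutoff equal to 1 for `‖x‖ ≤ M`, where any fixed point of `χ • f` must lie, and 0 for `‖x‖ ≥ M
  -- + 1`.
  let χ : E → ℝ := fun x => max 0 (min 1 (M + 1 - ‖x‖))
  have hχ : Continuous χ := by fun_prop
  have hχ0 : ∀ x, 0 ≤ χ x := fun x => le_max_left _ _
  have hχ1 : ∀ x, χ x ≤ 1 := fun x => max_le zero_le_one (min_le_left _ _)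
  have hcut : ∀ x, χ x • f x ≠ x := by
    intro x hx
    have hxM : ‖x‖ ≤ M := by
      rw [← hx, norm_smul, Real.norm_of_nonneg (hχ0 x)]
      exact (mul_le_of_le_one_left (norm_nonneg _) (hχ1 x)).trans (hM x)
    have : χ x = 1 := by
      simp only [χ]
      rw [min_eq_left (by linarith), max_eq_right zero_le_one]
    rw [this, one_smul] at hx
    exact hne x hx
  -- The error is below the displacement, so `g` has no fixed point; the support control makes `g`
  -- vanish on the sphere of radius `M + 1`, so normalizing `x - g x` fixes that sphere.
  obtain ⟨g, hg, hdist, hsupp⟩ := (hχ.smul hf).exists_contDiff_approx 1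
    (ε := fun x => ‖χ x • f x - x‖) ((hχ.smul hf).sub continuous_id).norm
    (fun x => norm_pos_iff.2 (sub_ne_zero.2 (hcut x)))
  have hgne : ∀ x, x - g x ≠ 0 := by
    intro x hx
    have := hdist x
    rw [← sub_eq_zero.1 hx, dist_eq_norm, norm_sub_rev] at this
    exact lt_irrefl _ this
  have hsm : ContDiff ℝ 1 (fun x => x - g x) := contDiff_id.sub hg
  have hR : 0 < M + 1 := by linarith
  refine not_exists_contDiff_retraction_sphere (R := M + 1)
    (r := fun x => ((M + 1) / ‖x - g x‖) • (x - g x)) ?_ hR ?_ ?_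
  · exact (contDiff_const.div (hsm.norm ℝ hgne) fun x => (norm_ne_zero_iff.2 (hgne x))).smul hsm
  · intro x
    rw [norm_smul, norm_div, norm_norm, div_mul_cancel₀ _ (norm_ne_zero_iff.2 (hgne x)),
      Real.norm_of_nonneg hR.le]
  · intro x hx
    have hgx : g x = 0 := by
      by_contra h
      exact hsupp h (by simp [χ, hx])
    simp [hgx, hx, hR.ne']

/-- **Brouwer's fixed point theorem** for compact convex subsets of a Euclidean space. -/
theorem exists_eq_self_of_mapsTo_convex_compact {T : Set E} (hne : T.Nonempty) (hT : IsCompact T)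
    (hconv : Convex ℝ T) {f : E → E} (hf : ContinuousOn f T) (hmaps : MapsTo f T T) :
    ∃ x ∈ T, f x = x := by
  obtain ⟨p, hpc, hpT, hpid⟩ := exists_continuous_retraction_of_convex hne hT.isComplete hconv
  obtain ⟨M, hM⟩ := hT.isBounded.exists_norm_le
  -- A fixed point of `f ∘ p` is a value of `f` on `T`, hence in `T`, where `p` is the identity.
  obtain ⟨x, hx⟩ := exists_eq_self_of_continuous_of_norm_le (f := f ∘ p)
    (hf.comp_continuous hpc hpT) (fun x => hM _ (hmaps (hpT x)))
  have hxT : x ∈ T := hx ▸ hmaps (hpT x)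
  exact ⟨x, hxT, by simpa [hpid x hxT] using hx⟩

end Brouwer

theorem theorem1 {n : ℕ} {k : Fin n → ℕ}
    (X : (i : Fin n) → Set (EuclideanSpace ℝ (Fin (k i))))
    (F : JointSpace k → JointSpace k) (hF : ContinuousOn F (jointStrategies X))
    (γ : ℝ) (T : Set (JointSpace k)) (hT : IsTrappingRegion X F γ T) :
    (∀ x : ℕ → JointSpace k, IsLearningTrajectory F γ x → x 0 ∈ T → ∀ t, x t ∈ T) ∧
    (Convex ℝ T → T.Nonempty → ∃ xstar ∈ interior T, IsLearningEquilibrium F xstar) := by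
  have hmaps : ∀ x ∈ T, learningStep F γ x ∈ T := fun x hx => interior_subset (hT.step_mem x hx)
  refine ⟨fun x hx h0 t => ?_, fun hconv hne => ?_⟩
  · induction t with
    | zero => exact h0
    | succ t ih => rw [hx t]; exact hmaps _ ih
  · have hcont : ContinuousOn (learningStep F γ) T :=
      continuousOn_id.add ((hF.mono hT.subset).const_smul γ)
    obtain ⟨x, hxT, hx⟩ := exists_eq_self_of_mapsTo_convex_compact hne hT.isCompact hconv hcont hmaps
    refine ⟨x, hx ▸ hT.step_mem x hxT, ?_⟩
    have h : γ • F x = 0 := by simpa [learningStep] using hx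
    exact (smul_eq_zero.1 h).resolve_left hT.rate_pos.ne'
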